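/- **Setting.** Let $\Omega\subset\mathbb R^3$ be a bounded polyhedral domain, triangulated by a finite conforming mesh $\mathcal T_h$ of tetrahedra. Let $\Gamma_i\subset\partial\Omega$ be a union of boundary triangles of the mesh (possibly empty, possibly all of $\partial\Omega$), let $\Gamma_o$ be the union of the remaining boundary triangles, let $n$ be the unit normal, and write $F_{\rm tan}=F-\langle F,n\rangle n$. Fix an order $k\ge 0$ and let * $H_{h,0}({\rm grad})$ be the Lagrange space of continuous functions on $\overline\Omega$ that are polynomials of degree $\le k+1$ on each tetrahedron and vanish on $\partial\Omega$; * $H_{h,\rm imp}({\rm curl})$ be the Nédélec space (first kind) of fields that on each tetrahedron lie in $(P_k)^3\oplus\{q \text{ homogeneous of degree } k+1:\ q(x)\cdot x=0\}$, have continuous tangential components across interior faces, and satisfy $v\wedge n=0$ on $\Gamma_o$; * $H_{h,\rm imp}({\rm div})$ be the Raviart–Thomas space of fields that on each tetrahedron lie in $(P_k)^3\oplus x\,\widetilde P_k$ ($\widetilde P_k$: homogeneous polynomials of degree $k$), have continuous normal components across interior faces, and satisfy $\langle v,n\rangle=0$ on $\Gamma_o$. Put $V_h=H_{h,\rm imp}({\rm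 div})\times H_{h,\rm imp}({\rm curl})\times H_{h,0}({\rm grad})$. Let $\tau>0$, let $\gamma$ be a real number with $1+\gamma\ge0$, and let $\varepsilon,\mu$ be positive continuous functions on $\Omega$ with $\varepsilon$ and $\mu^{-1}$ integrable over $\Omega$. With $(\cdot,\cdot)$ the $L^2(\Omega)$ inner product, $\|u\|_w^2=(wu,u)$ for a positive weight $w$, and $(E,F)_{\Gamma_i}=\int_{\Gamma_i}\langle E_{\rm tan},F_{\rm tan}\rangle\,dS$, $\|E\|_{\Gamma_i}^2=(E,E)_{\Gamma_i}$, define $$\begin{aligned} a(B,E,p;C,F,q)={}&\tfrac2\tau(\mu^{-1}B,C)+(\mu^{-1}{\rm curl}\,E,C)+({\rm div}\,B,{\rm div}\,C)\\ &+\tfrac2\tau(\varepsilon E,F)+(\varepsilon\,{\rm grad}\,p,F)-(\mu^{-1}B,{\rm curl}\,F)+(1+\gamma)(E,F)_{\Gamma_i}\\ &+\tfrac2\tau(p,q)-(\varepsilon E,{\rm grad}\,q), \end{aligned}$$ $$\|B\|_{\rm div}^2=\tfrac2\tau\|B\|_{\mu^{-1}}^2+\|{\rm div}\,B\|^2,\quad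 \|E\|_{\rm curl}^2=\tfrac2\tau\|E\|_\varepsilon^2+\tfrac\tau2\|{\rm curl}\,E\|_{\mu^{-1}}^2+(1+\gamma)\|E\|_{\Gamma_i}^2,\quad \|p\|_{\rm grad}^2=\tfrac2\tau\|p\|^2+\tfrac\tau2\|{\rm grad}\,p\|_\varepsilon^2,$$ and $|||(B,E,p)|||=\big(\|B\|_{\rm div}^2+\|E\|_{\rm curl}^2+\|p\|_{\rm grad}^2\big)^{1/2}$. **Theorem 3.1.** For every $U\in V_h$, $$\sup_{0\ne V\in V_h}\frac{a(U;V)}{|||V|||}\ \ge\ \frac14\,|||U||| ,$$ where the supremum is finite (and is read as $0$ if $V_h=\{0\}$). There is an absolute constant $C_b>0$, independent of $\Omega$, the mesh, the splitting of the boundary, $k$, $\tau$, $\gamma$, $\varepsilon$ and $\mu$, such that $$|a(U;V)|\le C_b\,|||U|||\,|||V|||\qquad\text{for all }U,V\in V_h .$$ Consequently the auxiliary problem is well-posed uniformly in all these data: for all linear functionals $g_B,g_E,g_p$ on the three factors of $V_h$ there is exactly one $U=(B,E,p)\in V_h$ such that, for all $(C,F,q)\in V_h$, $$\begin{aligned}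 \tfrac2\tau(\mu^{-1}B,C)+(\mu^{-1}{\rm curl}\,E,C)+({\rm div}\,B,{\rm div}\,C)&=g_B(C),\\ \tfrac2\tau(\varepsilon E,F)+(\varepsilon\,{\rm grad}\,p,F)-(\mu^{-1}B,{\rm curl}\,F)+(1+\gamma)(E,F)_{\Gamma_i}&=g_E(F),\\ \tfrac2\tau(p,q)-(\varepsilon E,{\rm grad}\,q)&=g_p(q), \end{aligned}$$ and if $K\ge0$ satisfies $|g_B(C)+g_E(F)+g_p(q)|\le K\,|||(C,F,q)|||$ for all $(C,F,q)\in V_h$, then $|||U|||\le 4K$. -/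

import Mathlib

open MeasureTheory

namespace MaxwellFEM

noncomputable section

/-- Physical space `ℝ³` with its Euclidean norm. -/
abbrev E3 : Type := EuclideanSpace ℝ (Fin 3)

/-- Real polynomials in the three Cartesian coordinates. -/
abbrev Poly : Type := MvPolynomial (Fin 3) ℝ

/-- Polynomial vector fields on `ℝ³`. -/
abbrev PolyVec : Type := Fin 3 → Poly

/-- The value of a polynomial at a point of `ℝ³`. -/
def evalS (q : Poly) (x : E3) : ℝ := MvPolynomial.eval x.ofLp q

/-- The value of a polynomial vector field at a point of `ℝ³`. -/
def evalV (u : PolyVec) (x : E3) : E3 := WithLp.toLp 2 fun i => evalS (u i) x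

/-- Gradient. -/
def grad (q : Poly) : PolyVec := fun i => MvPolynomial.pderiv i q

/-- Curl. -/
def curl (u : PolyVec) : PolyVec :=
  ![MvPolynomial.pderiv 1 (u 2) - MvPolynomial.pderiv 2 (u 1),
    MvPolynomial.pderiv 2 (u 0) - MvPolynomial.pderiv 0 (u 2),
    MvPolynomial.pderiv 0 (u 1) - MvPolynomial.pderiv 1 (u 0)]

/-- Divergence. -/
def div (u : PolyVec) : Poly := ∑ i, MvPolynomial.pderiv i (u i)

/-! ### Local polynomial spaces -/

/-- `P_k`: polynomials of total degree at most `k`. -/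
def polyS (k : ℕ) : Submodule ℝ Poly := MvPolynomial.restrictTotalDegree (Fin 3) ℝ k

/-- `(P_k)³`. -/
def polyV (k : ℕ) : Submodule ℝ PolyVec := Submodule.pi Set.univ fun _ => polyS k

/-- `{x ↦ q(x) x : q homogeneous of degree k}`. -/
def radial (k : ℕ) : Submodule ℝ PolyVec :=
  (MvPolynomial.homogeneousSubmodule (Fin 3) ℝ k).map
    (LinearMap.pi fun i => LinearMap.mulLeft ℝ (MvPolynomial.X i : Poly))

/-- Vector fields `q`, homogeneous of degree `k + 1`, with `q(x) · x = 0`. -/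
def rotational (k : ℕ) : Submodule ℝ PolyVec :=
  (Submodule.pi Set.univ fun _ => MvPolynomial.homogeneousSubmodule (Fin 3) ℝ (k + 1)) ⊓
    LinearMap.ker (∑ i : Fin 3,
      (LinearMap.mulLeft ℝ (MvPolynomial.X i : Poly)).comp
        (LinearMap.proj i : PolyVec →ₗ[ℝ] Poly))

/-- The Raviart--Thomas space on one tetrahedron; `k = 0` is the lowest order. -/
def rtLocal (k : ℕ) : Submodule ℝ PolyVec := polyV k ⊔ radial k

/-- The Nédélec space (of the first kind) on one tetrahedron; `k = 0` is the lowest order. -/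
def nedLocal (k : ℕ) : Submodule ℝ PolyVec := polyV k ⊔ rotational k

/-! ### Meshes -/

/-- The open set that the complex triangulates: the interior of the union of its closed cells. -/
def openDomain (K : Geometry.SimplicialComplex ℝ E3) : Set E3 := interior K.space

/-- Triangles of the complex that lie in the boundary of the domain. -/
def boundaryFaces (K : Geometry.SimplicialComplex ℝ E3) : Set (Finset E3) :=
  {G | G ∈ K.faces ∧ G.card = 3 ∧ convexHull ℝ (G : Set E3) ⊆ frontier (openDomain K)}

/-- A finite conforming tetrahedral mesh, with some of its boundary triangles marked as the
impedance boundary `Γ_i`. A simplex is the finite set of its vertices. -/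
structure Mesh where
  complex : Geometry.SimplicialComplex ℝ E3
  finite : complex.faces.Finite
  /-- Every simplex is a face of a tetrahedron of the mesh. -/
  pure : ∀ s ∈ complex.faces, ∃ t ∈ complex.faces, t.card = 4 ∧ s ⊆ t
  /-- The triangles that make up `Γ_i`; the other boundary triangles make up `Γ_o`. -/
  impedance : Finset (Finset E3)
  impedance_subset : ↑impedance ⊆ boundaryFaces complex

namespace Mesh

variable (M : Mesh)

/-- The computational domain `Ω`. -/
def domain : Set E3 := openDomain M.complex

/-- The tetrahedra of the mesh. -/
abbrev Tet : Type := {t : Finset E3 // t ∈ M.complex.faces ∧ t.card = 4}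

instance : Fintype M.Tet := (M.finite.subset fun _ h => h.1).fintype

/-- The closed tetrahedron (or triangle) with the given vertices. -/
abbrev cell (s : Finset E3) : Set E3 := convexHull ℝ (s : Set E3)

/-- The triangles that make up `Γ_o`. -/
def essential : Set (Finset E3) := boundaryFaces M.complex \ ↑M.impedance

/-- Orthogonal projection onto the plane directions of a triangle: the tangential part
`v - ⟨v, n⟩ n`, which vanishes iff `v ∧ n = 0`. -/
def tang (G : Finset E3) : E3 →L[ℝ] E3 := (vectorSpan ℝ (G : Set E3)).starProjection

/-- Orthogonal projection onto the normal line of a triangle: the normal part `⟨v, n⟩ n`. -/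
def norml (G : Finset E3) : E3 →L[ℝ] E3 := (vectorSpan ℝ (G : Set E3))ᗮ.starProjection

/-! ### Piecewise polynomials

A piecewise polynomial is stored as the family of its polynomials on the tetrahedra. Differential
operators act tetrahedron by tetrahedron; on the conforming spaces below this is the
(distributional) differential operator on `Ω`. -/

/-- The function on `Ω` (defined off the null set of cell boundaries) of a piecewise
polynomial. -/
def glueS (u : M.Tet → Poly) (x : E3) : ℝ :=
  ∑ t : M.Tet, (interior (cell t.1)).indicator (evalS (u t)) x

/-- The vector field on `Ω` (defined off the null set of cell boundaries) of a piecewise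
polynomial vector field. -/
def glueV (u : M.Tet → PolyVec) (x : E3) : E3 :=
  ∑ t : M.Tet, (interior (cell t.1)).indicator (evalV (u t)) x

/-- The `L²(Ω)` pairing `(u, v)` of scalar functions. -/
def ipS (u v : M.Tet → Poly) : ℝ :=
  ∫ x in M.domain, M.glueS u x * M.glueS v x

/-- The weighted `L²(Ω)` pairing `(w u, v)` of vector fields. -/
def ipV (w : E3 → ℝ) (u v : M.Tet → PolyVec) : ℝ :=
  ∫ x in M.domain, w x * inner ℝ (M.glueV u x) (M.glueV v x)

open Classical in
/-- `∫_{Γ_i} ⟨u_tan, v_tan⟩ dS`, with the traces taken from the tetrahedron that has the boundary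
triangle as a face (there is exactly one). -/
def ipBdry (u v : M.Tet → PolyVec) : ℝ :=
  ∑ G ∈ M.impedance, ∑ t : M.Tet with G ⊆ t.1,
    ∫ x in cell G, inner ℝ (tang G (evalV (u t) x)) (tang G (evalV (v t) x)) ∂μHE[2]

/-! ### Conforming finite element spaces -/

/-- Lagrange elements `H_{h,0}(grad)`: continuous piecewise polynomials of degree `k + 1` that
vanish on `∂Ω`. -/
def hGrad (k : ℕ) : Submodule ℝ (M.Tet → Poly) where
  carrier := {p | (∀ t, p t ∈ polyS (k + 1)) ∧
    (∀ t t' : M.Tet, ∀ x ∈ cell t.1 ∩ cell t'.1, evalS (p t) x = evalS (p t') x) ∧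
    (∀ t : M.Tet, ∀ x ∈ cell t.1 ∩ frontier M.domain, evalS (p t) x = 0)}
  zero_mem' := by
    refine ⟨fun t => zero_mem _, ?_, ?_⟩ <;> simp [evalS]
  add_mem' := by
    rintro p q ⟨h1, h2, h3⟩ ⟨g1, g2, g3⟩
    refine ⟨fun t => add_mem (h1 t) (g1 t), fun t t' x hx => ?_, fun t x hx => ?_⟩
    · have := h2 t t' x hx
      have := g2 t t' x hx
      simp_all [evalS]
    · have := h3 t x hx
      have := g3 t x hx
      simp_all [evalS]
  smul_mem' := by
    rintro c p ⟨h1, h2, h3⟩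
    refine ⟨fun t => Submodule.smul_mem _ c (h1 t), fun t t' x hx => ?_, fun t x hx => ?_⟩
    · have := h2 t t' x hx
      simp_all [evalS]
    · have := h3 t x hx
      simp_all [evalS]

theorem evalV_zero (x : E3) : evalV 0 x = 0 := by
  ext i; simp [evalV, evalS]

theorem evalV_add (u v : PolyVec) (x : E3) : evalV (u + v) x = evalV u x + evalV v x := by
  ext i; simp [evalV, evalS]

theorem evalV_smul (c : ℝ) (u : PolyVec) (x : E3) : evalV (c • u) x = c • evalV u x := by
  ext i; simp [evalV, evalS]

/-- Piecewise fields in the local space `P` whose trace `tr` on triangles is continuous across the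
triangles inside `Ω` and vanishes on `Γ_o`. -/
def conforming (P : Submodule ℝ PolyVec) (tr : Finset E3 → E3 →L[ℝ] E3) :
    Submodule ℝ (M.Tet → PolyVec) where
  carrier := {u | (∀ t, u t ∈ P) ∧
    (∀ G ∈ M.complex.faces, G.card = 3 → ∀ t t' : M.Tet, G ⊆ t.1 → G ⊆ t'.1 →
      ∀ x ∈ cell G, tr G (evalV (u t) x) = tr G (evalV (u t') x)) ∧
    (∀ G ∈ M.essential, ∀ t : M.Tet, G ⊆ t.1 → ∀ x ∈ cell G, tr G (evalV (u t) x) = 0)}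
  zero_mem' := by
    refine ⟨fun t => zero_mem _, ?_, ?_⟩ <;> simp [evalV_zero]
  add_mem' := by
    rintro p q ⟨h1, h2, h3⟩ ⟨g1, g2, g3⟩
    refine ⟨fun t => add_mem (h1 t) (g1 t), fun G hG hc t t' ht ht' x hx => ?_,
      fun G hG t ht x hx => ?_⟩
    · simp [evalV_add, h2 G hG hc t t' ht ht' x hx, g2 G hG hc t t' ht ht' x hx]
    · simp [evalV_add, h3 G hG t ht x hx, g3 G hG t ht x hx]
  smul_mem' := by
    rintro c p ⟨h1, h2, h3⟩
    refine ⟨fun t => Submodule.smul_mem _ c (h1 t), fun G hG hc t t' ht ht' x hx => ?_,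
      fun G hG t ht x hx => ?_⟩
    · simp [evalV_smul, h2 G hG hc t t' ht ht' x hx]
    · simp [evalV_smul, h3 G hG t ht x hx]

/-- Nédélec elements `H_{h,imp}(curl)`: tangential continuity, zero tangential trace on `Γ_o`. -/
def hCurl (k : ℕ) : Submodule ℝ (M.Tet → PolyVec) := M.conforming (nedLocal k) tang

/-- Raviart--Thomas elements `H_{h,imp}(div)`: normal continuity, zero normal trace on `Γ_o`. -/
def hDiv (k : ℕ) : Submodule ℝ (M.Tet → PolyVec) := M.conforming (rtLocal k) norml

/-- `V_h = H_{h,imp}(div) × H_{h,imp}(curl) × H_{h,0}(grad)`, with elements `(B, E, p)`. -/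
abbrev Vh (k : ℕ) : Type := M.hDiv k × M.hCurl k × M.hGrad k

/-! ### The auxiliary problem -/

variable {M} {k : ℕ} (τ γ : ℝ) (ε μ : E3 → ℝ)

/-- First row (tested with `C`) of the auxiliary system. -/
def rowB (U : M.Vh k) (C : M.hDiv k) : ℝ :=
  2 / τ * M.ipV (fun x => (μ x)⁻¹) U.1 C
    + M.ipV (fun x => (μ x)⁻¹) (fun t => curl (U.2.1.1 t)) C
    + M.ipS (fun t => div (U.1.1 t)) (fun t => div (C.1 t))

/-- Second row (tested with `F`) of the auxiliary system. -/
def rowE (U : M.Vh k) (F : M.hCurl k) : ℝ :=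
  2 / τ * M.ipV ε U.2.1 F
    + M.ipV ε (fun t => grad (U.2.2.1 t)) F
    - M.ipV (fun x => (μ x)⁻¹) U.1 (fun t => curl (F.1 t))
    + (1 + γ) * M.ipBdry U.2.1 F

/-- Third row (tested with `q`) of the auxiliary system. -/
def rowP (U : M.Vh k) (q : M.hGrad k) : ℝ :=
  2 / τ * M.ipS U.2.2 q - M.ipV ε U.2.1 (fun t => grad (q.1 t))

/-- The bilinear form `a(B, E, p; C, F, q)`. -/
def auxForm (U V : M.Vh k) : ℝ :=
  rowB τ μ U V.1 + rowE τ γ ε μ U V.2.1 + rowP τ ε U V.2.2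

/-- `‖B‖²_div`. -/
def normSqDiv (B : M.hDiv k) : ℝ :=
  2 / τ * M.ipV (fun x => (μ x)⁻¹) B B
    + M.ipS (fun t => div (B.1 t)) (fun t => div (B.1 t))

/-- `‖E‖²_curl`. -/
def normSqCurl (E : M.hCurl k) : ℝ :=
  2 / τ * M.ipV ε E E
    + τ / 2 * M.ipV (fun x => (μ x)⁻¹) (fun t => curl (E.1 t)) (fun t => curl (E.1 t))
    + (1 + γ) * M.ipBdry E E

/-- `‖p‖²_grad`. -/
def normSqGrad (p : M.hGrad k) : ℝ :=
  2 / τ * M.ipS p p + τ / 2 * M.ipV ε (fun t => grad (p.1 t)) (fun t => grad (p.1 t))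

/-- `(‖B‖²_div + ‖E‖²_curl + ‖p‖²_grad)^{1/2}`. -/
def nrm (U : M.Vh k) : ℝ :=
  √(normSqDiv τ μ U.1 + normSqCurl τ γ ε μ U.2.1 + normSqGrad τ ε U.2.2)

/-- `U = (B, E, p)` solves the auxiliary problem with right-hand sides `g_B`, `g_E`, `g_p` in the
dual spaces. -/
def IsAuxSolution (gB : M.hDiv k →ₗ[ℝ] ℝ) (gE : M.hCurl k →ₗ[ℝ] ℝ) (gp : M.hGrad k →ₗ[ℝ] ℝ)
    (U : M.Vh k) : Prop :=
  (∀ C, rowB τ μ U C = gB C) ∧ (∀ F, rowE τ γ ε μ U F = gE F) ∧ (∀ q, rowP τ ε U q = gp q)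

end Mesh

end

end MaxwellFEM

/-! The spaces form a discrete complex: `grad` maps $H_{h,0}({\rm grad})$ into $H_{h,\rm imp}({\rm
curl})$, `curl` maps that into $H_{h,\rm imp}({\rm div})$, and curl grad = 0, div curl = 0
(`grad_mem_hCurl`, `curl_mem_hDiv`). Hence $V=(B+\frac\tau2{\rm curl}\,E,\ E+\frac\tau2{\rm
grad}\,p,\ p)$ is an admissible test function. The added parts produce the missing squares
$\frac\tau2\|{\rm curl}\,E\|^2_{\mu^{-1}}$ and $\frac\tau2\|{\rm grad}\,p\|^2_\varepsilon$ and leave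
no boundary term, since $p=0$ on $\partial\Omega$. What remains is
$$a(U;V)=|||U|||^2+(\mu^{-1}B,{\rm curl}\,E)+(\varepsilon E,{\rm grad}\,p).$$ Young's inequality
with the weights $2/\tau$, $\tau/2$ of the norm absorbs half, so $a(U;V)\ge\frac12|||U|||^2$
(`nrm_sq_le_auxForm_testFn`), and also gives $|||V|||\le2|||U|||$ (`nrm_testFn_le`). The quotient is
the constant 1/4.

Boundedness is Cauchy–Schwarz applied to each of the nine terms of $a$. The inf-sup bound makes
$U\mapsto a(U;\cdot)$ injective; in finite dimension it is then bijective onto the dual, and the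
same bound is the stability estimate. -/

namespace MaxwellFEM

/-! ### Calculus of polynomials -/

/-- The commutator of two derivations is a derivation, and this one kills every variable. -/
theorem pderiv_comm (i j : Fin 3) (q : Poly) :
    MvPolynomial.pderiv i (MvPolynomial.pderiv j q) =
      MvPolynomial.pderiv j (MvPolynomial.pderiv i q) := by
  have h : ⁅(MvPolynomial.pderiv i : Derivation ℝ Poly Poly),
      (MvPolynomial.pderiv j : Derivation ℝ Poly Poly)⁆ = 0 := by
    apply MvPolynomial.derivation_ext
    intro l
    simp only [Derivation.commutator_apply, MvPolynomial.pderiv_X, Derivation.coe_zero,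
      Pi.zero_apply, Pi.single_apply]
    split_ifs <;> simp
  have h2 := congrArg (fun D : Derivation ℝ Poly Poly => D q) h
  simpa [Derivation.commutator_apply, sub_eq_zero] using h2

theorem curl_grad (q : Poly) : curl (grad q) = 0 := by
  ext1 i
  fin_cases i <;> simp [curl, grad, pderiv_comm]

theorem div_curl (u : PolyVec) : div (curl u) = 0 := by
  simp only [div, curl, Fin.sum_univ_three, Matrix.cons_val, map_sub]
  rw [pderiv_comm 1 0, pderiv_comm 2 0, pderiv_comm 2 1]
  ring

theorem grad_add (p q : Poly) : grad (p + q) = grad p + grad q := by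
  ext1 i; simp [grad]

theorem grad_sub (p q : Poly) : grad (p - q) = grad p - grad q := by
  ext1 i; simp [grad]

theorem grad_smul (c : ℝ) (q : Poly) : grad (c • q) = c • grad q := by
  ext1 i; simp [grad]

theorem curl_add (u v : PolyVec) : curl (u + v) = curl u + curl v := by
  ext1 i
  fin_cases i <;> simp [curl] <;> ring

theorem curl_sub (u v : PolyVec) : curl (u - v) = curl u - curl v := by
  ext1 i
  fin_cases i <;> simp [curl] <;> ring

theorem curl_smul (c : ℝ) (u : PolyVec) : curl (c • u) = c • curl u := by
  ext1 i
  fin_cases i <;> simp [curl, smul_sub]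

theorem div_add (u v : PolyVec) : div (u + v) = div u + div v := by
  simp [div, Finset.sum_add_distrib]

theorem div_smul (c : ℝ) (u : PolyVec) : div (c • u) = c • div u := by
  simp [div, Finset.smul_sum]

/-! ### Degrees and finite dimension of the local spaces -/

theorem pderiv_mem_polyS {k : ℕ} {q : Poly} (hq : q ∈ polyS (k + 1)) (i : Fin 3) :
    MvPolynomial.pderiv i q ∈ polyS k := by
  rw [polyS, MvPolynomial.mem_restrictTotalDegree] at hq ⊢
  refine Finset.sup_le fun m hm => ?_
  rw [MvPolynomial.mem_support_iff, MvPolynomial.coeff_pderiv] at hm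
  -- The coefficient of `m` in the derivative is a multiple of the coefficient of `q` at `m` with
  -- the `i`-th exponent raised by one.
  have h := MvPolynomial.le_totalDegree
    (MvPolynomial.mem_support_iff.2 (left_ne_zero_of_mul hm))
  rw [Finsupp.sum_add_index' (by simp) (by simp)] at h
  simp at h
  omega

theorem grad_mem_polyV {k : ℕ} {q : Poly} (hq : q ∈ polyS (k + 1)) : grad q ∈ polyV k :=
  fun i _ => pderiv_mem_polyS hq i

theorem curl_mem_polyV {k : ℕ} {u : PolyVec} (hu : u ∈ polyV (k + 1)) : curl u ∈ polyV k := by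
  have h (i j : Fin 3) : MvPolynomial.pderiv i (u j) ∈ polyS k :=
    pderiv_mem_polyS (hu j (Set.mem_univ j)) i
  intro i _
  fin_cases i <;> exact sub_mem (h _ _) (h _ _)

theorem homogeneousSubmodule_le_polyS (k : ℕ) :
    MvPolynomial.homogeneousSubmodule (Fin 3) ℝ k ≤ polyS k := by
  intro q hq
  rw [polyS, MvPolynomial.mem_restrictTotalDegree]
  exact MvPolynomial.IsHomogeneous.totalDegree_le hq

theorem polyS_mono {k l : ℕ} (h : k ≤ l) : polyS k ≤ polyS l := by
  intro q hq
  rw [polyS, MvPolynomial.mem_restrictTotalDegree] at hq ⊢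
  omega

theorem polyV_mono {k l : ℕ} (h : k ≤ l) : polyV k ≤ polyV l :=
  fun _ hu i hi => polyS_mono h (hu i hi)

theorem nedLocal_le_polyV (k : ℕ) : nedLocal k ≤ polyV (k + 1) := by
  refine sup_le (polyV_mono k.le_succ) fun u hu i hi => ?_
  exact homogeneousSubmodule_le_polyS _ (hu.1 i hi)

theorem rtLocal_le_polyV (k : ℕ) : rtLocal k ≤ polyV (k + 1) := by
  refine sup_le (polyV_mono k.le_succ) ?_
  rintro _ ⟨q, hq, rfl⟩ i -
  apply homogeneousSubmodule_le_polyS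
  have := (MvPolynomial.isHomogeneous_X ℝ i).mul
    ((MvPolynomial.mem_homogeneousSubmodule _ _).1 hq)
  rw [add_comm] at this
  exact this

instance finiteDimensional_polyS (k : ℕ) : FiniteDimensional ℝ (polyS k) :=
  inferInstanceAs (Module.Finite ℝ (MvPolynomial.restrictTotalDegree (Fin 3) ℝ k))

/-- Such an `S` embeds in a finite power of `P`. Serves both for vector fields (`ι = Fin 3`) and for
piecewise polynomials (`ι` the tetrahedra). -/
theorem finiteDimensional_pi_of_mem {ι V : Type*} [Finite ι] [AddCommGroup V] [Module ℝ V]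
    (P : Submodule ℝ V) [FiniteDimensional ℝ P] (S : Submodule ℝ (ι → V))
    (h : ∀ u ∈ S, ∀ i, u i ∈ P) : FiniteDimensional ℝ S := by
  let f : S →ₗ[ℝ] ι → P :=
    LinearMap.pi fun i => LinearMap.codRestrict P ((LinearMap.proj i).comp S.subtype)
      fun u => h u.1 u.2 i
  refine FiniteDimensional.of_injective f fun u v huv => ?_
  ext1
  funext i
  exact congrArg Subtype.val (congrFun huv i)

instance finiteDimensional_polyV (k : ℕ) : FiniteDimensional ℝ (polyV k) :=
  finiteDimensional_pi_of_mem (polyS k) (polyV k) fun _ hu i => hu i (Set.mem_univ i)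

/-! ### Evaluation -/

theorem evalS_sub (p q : Poly) (x : E3) : evalS (p - q) x = evalS p x - evalS q x := by
  simp [evalS]

theorem evalV_sub (u v : PolyVec) (x : E3) : evalV (u - v) x = evalV u x - evalV v x := by
  ext i; simp [evalV, evalS]

@[fun_prop]
theorem continuous_evalS (q : Poly) : Continuous (evalS q) :=
  (MvPolynomial.continuous_eval q).comp (PiLp.continuous_ofLp 2 _)

@[fun_prop]
theorem continuous_evalV (u : PolyVec) : Continuous (evalV u) :=
  (PiLp.continuous_toLp 2 _).comp (continuous_pi fun i => continuous_evalS (u i))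

theorem eq_zero_of_evalS_eq_zero {q : Poly} {s : Set E3} (hs : IsOpen s) (hne : s.Nonempty)
    (h : ∀ x ∈ s, evalS q x = 0) : q = 0 := by
  obtain ⟨x, hx⟩ := hne
  have ho : IsOpen ((WithLp.toLp 2 : (Fin 3 → ℝ) → E3) ⁻¹' s) :=
    hs.preimage (PiLp.continuous_toLp 2 _)
  obtain ⟨r, hr, hb⟩ := Metric.isOpen_iff.1 ho x.ofLp hx
  -- A ball of the sup norm is a product of intervals, and a polynomial that vanishes on a product
  -- of infinite sets is zero.
  refine MvPolynomial.funext_set (fun i => Metric.ball (x i) r) (fun i => ?_) fun y hy => ?_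
  · rw [Real.ball_eq_Ioo]
    exact Set.Ioo_infinite (by linarith)
  · have : y ∈ Metric.ball x.ofLp r := by
      rw [← ball_pi _ hr] at hy
      exact hy
    simpa [evalS] using h _ (hb this)

/-- Ties the formal derivatives to analysis: the formal gradient gives the directional derivatives
of the evaluated polynomial. -/
theorem hasDerivAt_evalS_line (q : Poly) (x v : E3) (s : ℝ) :
    HasDerivAt (fun s : ℝ => evalS q (x + s • v)) (inner ℝ v (evalV (grad q) (x + s • v))) s := by
  have hin (q : Poly) (y : E3) : inner ℝ v (evalV (grad q) y) =
      ∑ i, v i * evalS (MvPolynomial.pderiv i q) y := by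
    simp [PiLp.inner_apply, evalV, grad, mul_comm]
  simp only [hin]
  induction q using MvPolynomial.induction_on with
  | C a => simpa [evalS] using hasDerivAt_const s a
  | add p q hp hq =>
    convert! hp.add hq using 1
    · ext s; simp [evalS]
    · simp [evalS, mul_add, Finset.sum_add_distrib]
  | mul_X p i hp =>
    have h1 : HasDerivAt (fun s : ℝ => x i + s * v i) (v i) s := by
      simpa using ((hasDerivAt_id s).mul_const (v i)).const_add (x i)
    convert! hp.mul h1 using 1
    · ext s; simp [evalS]
    · simp only [Fin.sum_univ_three, evalS, MvPolynomial.pderiv_mul, map_add, map_mul,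
        MvPolynomial.pderiv_X, MvPolynomial.eval_X, Pi.single_apply]
      fin_cases i <;> simp <;> ring

namespace Mesh

/-! ### Traces of gradients and curls on a triangle -/

theorem inner_evalV_grad_eq_zero {G : Finset E3} {q : Poly}
    (h : ∀ x ∈ cell G, evalS q x = 0) {x : E3} (hx : x ∈ cell G) {a : E3}
    (ha : a ∈ vectorSpan ℝ (G : Set E3)) : inner ℝ a (evalV (grad q) x) = 0 := by
  -- `q` vanishes along the segment from `x` to `y`. The derivative is taken within [0, 1] because
  -- `x` may lie on the relative boundary of the cell.
  have key (y : E3) (hy : y ∈ cell G) : inner ℝ (y - x) (evalV (grad q) x) = 0 := by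
    have h1 : HasDerivWithinAt (fun s : ℝ => evalS q (x + s • (y - x)))
        (inner ℝ (y - x) (evalV (grad q) x)) (Set.Icc 0 1) 0 := by
      simpa using (hasDerivAt_evalS_line q x (y - x) 0).hasDerivWithinAt
    have h2 : HasDerivWithinAt (fun s : ℝ => evalS q (x + s • (y - x))) 0 (Set.Icc 0 1) 0 := by
      refine (hasDerivWithinAt_const (0 : ℝ) (Set.Icc (0 : ℝ) 1) (0 : ℝ)).congr
        (fun s hs => h _ ((convex_convexHull ℝ _).add_smul_sub_mem hx hy hs)) ?_
      simpa using h x hx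
    exact (uniqueDiffOn_Icc zero_lt_one 0 (by simp)).eq_deriv _ h1 h2
  have hle : vectorSpan ℝ (G : Set E3) ≤ LinearMap.ker (innerₛₗ ℝ (evalV (grad q) x)) := by
    refine Submodule.span_le.2 ?_
    rintro _ ⟨y, hy, z, hz, rfl⟩
    have h1 := key y (subset_convexHull ℝ _ hy)
    have h2 := key z (subset_convexHull ℝ _ hz)
    rw [real_inner_comm] at h1 h2
    change inner ℝ _ (y - z) = 0
    rw [← sub_sub_sub_cancel_right y z x, inner_sub_right, h1, h2, sub_zero]
  have := hle ha
  rw [real_inner_comm]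
  simpa using this

theorem tang_eq_zero_iff {G : Finset E3} {v : E3} :
    tang G v = 0 ↔ ∀ a ∈ vectorSpan ℝ (G : Set E3), inner ℝ a v = 0 := by
  rw [tang, Submodule.starProjection_apply_eq_zero_iff, Submodule.mem_orthogonal]

theorem tang_evalV_grad {G : Finset E3} {q : Poly} (h : ∀ x ∈ cell G, evalS q x = 0) {x : E3}
    (hx : x ∈ cell G) : tang G (evalV (grad q) x) = 0 :=
  tang_eq_zero_iff.2 fun _ ha => inner_evalV_grad_eq_zero h hx ha

/-- The component of the curl along `a × b` is `∂_a ⟨u, b⟩ - ∂_b ⟨u, a⟩`. -/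
theorem inner_evalV_curl_cross (u : PolyVec) (a b x : E3) :
    inner ℝ (WithLp.toLp 2 (crossProduct a.ofLp b.ofLp) : E3) (evalV (curl u) x) =
      inner ℝ a (evalV (grad (∑ i, b i • u i)) x) -
        inner ℝ b (evalV (grad (∑ i, a i • u i)) x) := by
  simp [PiLp.inner_apply, Fin.sum_univ_three, evalV, evalS, grad, curl, cross_apply]
  ring

theorem evalS_sum_smul (u : PolyVec) (a x : E3) :
    evalS (∑ i, a i • u i) x = inner ℝ a (evalV u x) := by
  simp [PiLp.inner_apply, evalV, evalS, mul_comm]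

/-- The normal part of the curl depends only on the tangential trace. For edge vectors `a`, `b` the
polynomials ⟨u, a⟩ and ⟨u, b⟩ vanish on the triangle, hence so do their derivatives along `b` and
`a`; their difference is the component of the curl along `a × b`, which spans the normal line. -/
theorem norml_evalV_curl {G : Finset E3} (hG : AffineIndependent ℝ ((↑) : G → E3))
    (hcard : G.card = 3) {u : PolyVec} (h : ∀ x ∈ cell G, tang G (evalV u x) = 0) {x : E3}
    (hx : x ∈ cell G) : norml G (evalV (curl u) x) = 0 := by
  classical
  obtain ⟨p, q, r, hpq, hpr, hqr, rfl⟩ := Finset.card_eq_three.1 hcard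
  set S := vectorSpan ℝ (({p, q, r} : Finset E3) : Set E3) with hS
  have hp : p ∈ (({p, q, r} : Finset E3) : Set E3) := by simp
  have hq : q ∈ (({p, q, r} : Finset E3) : Set E3) := by simp
  have hr : r ∈ (({p, q, r} : Finset E3) : Set E3) := by simp
  have ha : q - p ∈ S := vsub_mem_vectorSpan ℝ hq hp
  have hb : r - p ∈ S := vsub_mem_vectorSpan ℝ hr hp
  have hlin : LinearIndependent ℝ ![q - p, r - p] := by
    let f : Fin 3 → ({p, q, r} : Finset E3) := ![⟨p, hp⟩, ⟨q, hq⟩, ⟨r, hr⟩]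
    have hf : Function.Injective f := by
      intro i j
      fin_cases i <;> fin_cases j <;> simp [f, hpq, hpr, hqr, hpq.symm, hpr.symm, hqr.symm]
    have h3 : AffineIndependent ℝ ((↑) ∘ f : Fin 3 → E3) := hG.comp_embedding ⟨f, hf⟩
    rw [affineIndependent_iff_linearIndependent_vsub ℝ _ (0 : Fin 3)] at h3
    have h4 := h3.comp (fun i : Fin 2 => (⟨i.succ, Fin.succ_ne_zero i⟩ : {x : Fin 3 // x ≠ 0}))
      fun i j hij => by simpa using hij
    convert! h4 using 1
    ext1 i
    fin_cases i <;> rfl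
  generalize q - p = a at *
  generalize r - p = b at *
  set n := norml {p, q, r} (evalV (curl u) x) with hn
  have hnmem : n ∈ Sᗮ := Submodule.starProjection_apply_mem _ _
  have hcross : crossProduct a.ofLp b.ofLp ≠ 0 := by
    rw [crossProduct_ne_zero_iff_linearIndependent]
    have := hlin.map' (WithLp.linearEquiv 2 ℝ (Fin 3 → ℝ)).toLinearMap (LinearEquiv.ker _)
    convert! this using 1
    ext1 i
    fin_cases i <;> rfl
  have hvan (c : E3) (hc : c ∈ S) : ∀ y ∈ cell {p, q, r}, evalS (∑ i, c i • u i) y = 0 := by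
    intro y hy
    rw [evalS_sum_smul]
    exact tang_eq_zero_iff.1 (h y hy) c hc
  have hcurl : inner ℝ (WithLp.toLp 2 (crossProduct a.ofLp b.ofLp) : E3)
      (evalV (curl u) x) = 0 := by
    rw [inner_evalV_curl_cross, inner_evalV_grad_eq_zero (hvan b hb) hx ha,
      inner_evalV_grad_eq_zero (hvan a ha) hx hb, sub_zero]
  have hna : n.ofLp ⬝ᵥ a.ofLp = 0 := by
    simpa [EuclideanSpace.inner_eq_star_dotProduct] using (Submodule.mem_orthogonal _ _).1 hnmem a ha
  have hnb : n.ofLp ⬝ᵥ b.ofLp = 0 := by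
    simpa [EuclideanSpace.inner_eq_star_dotProduct] using (Submodule.mem_orthogonal _ _).1 hnmem b hb
  -- `n` is a multiple of `a × b`
  obtain ⟨c, hc⟩ : ∃ c : ℝ, n = c • (WithLp.toLp 2 (crossProduct a.ofLp b.ofLp) : E3) := by
    set w := crossProduct a.ofLp b.ofLp with hw
    -- As `n` is orthogonal to `a` and `b`, `w × n = 0`; then `(w × n) × w = (w · w) n - (n · w) w`
    -- exhibits `n` as a multiple of `w`.
    have h0 : crossProduct w n.ofLp = 0 := by
      rw [hw, cross_cross_eq_smul_sub_smul, dotProduct_comm, hna, dotProduct_comm, hnb]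
      simp
    have h1 := cross_cross_eq_smul_sub_smul w n.ofLp w
    rw [h0] at h1
    have hww : w ⬝ᵥ w ≠ 0 := fun h => hcross (dotProduct_self_eq_zero.1 h)
    refine ⟨(w ⬝ᵥ w)⁻¹ * (n.ofLp ⬝ᵥ w), ?_⟩
    have h2 : (w ⬝ᵥ w) • n.ofLp = (n.ofLp ⬝ᵥ w) • w := by
      simp at h1
      exact sub_eq_zero.1 h1.symm
    apply (WithLp.linearEquiv 2 ℝ (Fin 3 → ℝ)).injective
    simp only [WithLp.linearEquiv_apply, map_smul]
    change n.ofLp = _ • w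
    rw [mul_smul, ← h2, smul_smul, inv_mul_cancel₀ hww, one_smul]
  -- `n` is an orthogonal projection of the curl; being also a multiple of `a × b`, it is orthogonal
  -- to the curl, so ⟨n, n⟩ = 0.
  have hself : inner ℝ n n = inner ℝ n (evalV (curl u) x) := by
    have := Submodule.starProjection_inner_eq_zero (K := Sᗮ) (evalV (curl u) x) n hnmem
    rw [inner_sub_left, sub_eq_zero] at this
    rw [real_inner_comm (evalV (curl u) x) n]
    exact this.symm
  rw [hc, inner_smul_left (y := evalV (curl u) x), hcurl, mul_zero, ← hc] at hself
  exact inner_self_eq_zero.1 hself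

variable {M : Mesh} {k : ℕ}

/-! ### The discrete complex -/

theorem grad_mem_hCurl (p : M.hGrad k) : (fun t => grad (p.1 t)) ∈ M.hCurl k := by
  obtain ⟨hloc, hcont, hbd⟩ := p.2
  refine ⟨fun t => Submodule.mem_sup_left (grad_mem_polyV (hloc t)),
    fun G _ _ t t' ht ht' x hx => ?_, fun G hG t ht x hx => ?_⟩
  -- By continuity the difference of the two neighbouring polynomials vanishes on the shared
  -- triangle, so the trace lemma applies to it.
  · rw [← sub_eq_zero, ← map_sub, ← evalV_sub, ← grad_sub]
    refine tang_evalV_grad (fun y hy => ?_) hx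
    rw [evalS_sub, sub_eq_zero]
    exact hcont t t' y ⟨convexHull_mono ht hy, convexHull_mono ht' hy⟩
  · exact tang_evalV_grad (fun y hy => hbd t y ⟨convexHull_mono ht hy, hG.1.2.2 hy⟩) hx

theorem curl_mem_hDiv (E : M.hCurl k) : (fun t => curl (E.1 t)) ∈ M.hDiv k := by
  obtain ⟨hloc, hcont, hbd⟩ := E.2
  refine ⟨fun t => Submodule.mem_sup_left (curl_mem_polyV (nedLocal_le_polyV k (hloc t))),
    fun G hG hc t t' ht ht' x hx => ?_, fun G hG t ht x hx => ?_⟩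
  · rw [← sub_eq_zero, ← map_sub, ← evalV_sub, ← curl_sub]
    refine norml_evalV_curl (M.complex.indep hG) hc (fun y hy => ?_) hx
    rw [evalV_sub, map_sub, sub_eq_zero]
    exact hcont G hG hc t t' ht ht' y hy
  · exact norml_evalV_curl (M.complex.indep hG.1.1) hG.1.2.1 (fun y hy => hbd G hG t ht y hy) hx

instance : FiniteDimensional ℝ (M.hGrad k) :=
  finiteDimensional_pi_of_mem (polyS (k + 1)) _ fun _ hp => hp.1

instance : FiniteDimensional ℝ (M.hCurl k) :=
  finiteDimensional_pi_of_mem (polyV (k + 1)) _ fun _ hu t => nedLocal_le_polyV k (hu.1 t)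

instance : FiniteDimensional ℝ (M.hDiv k) :=
  finiteDimensional_pi_of_mem (polyV (k + 1)) _ fun _ hu t => rtLocal_le_polyV k (hu.1 t)

end Mesh

end MaxwellFEM

namespace MaxwellFEM

namespace Mesh

variable {M : Mesh} {k : ℕ}

/-! ### Geometry of the mesh -/

theorem isCompact_cell (s : Finset E3) : IsCompact (cell s) :=
  s.finite_toSet.isCompact_convexHull ℝ

theorem cell_subset_space {s : Finset E3} (hs : s ∈ M.complex.faces) :
    cell s ⊆ M.complex.space :=
  Geometry.SimplicialComplex.convexHull_subset_space hs

theorem interior_cell_subset_domain (t : M.Tet) : interior (cell t.1) ⊆ M.domain :=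
  interior_mono (cell_subset_space t.2.1)

theorem interior_cell_nonempty_iff {s : Finset E3} (hs : AffineIndependent ℝ ((↑) : s → E3)) :
    (interior (cell s)).Nonempty ↔ s.card = 4 := by
  have h := hs.affineSpan_eq_top_iff_card_eq_finrank_add_one
  rw [Subtype.range_coe_subtype] at h
  rw [interior_convexHull_nonempty_iff_affineSpan_eq_top]
  simpa using h

/-- In a complex the two cells meet within the hull of their common vertices. If the interiors meet,
this hull has interior points, so there are four common vertices. -/
theorem eq_of_mem_interior_cell {t t' : M.Tet} {x : E3} (hx : x ∈ interior (cell t.1))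
    (hx' : x ∈ interior (cell t'.1)) : t = t' := by
  classical
  have hsub : interior (cell t.1) ∩ interior (cell t'.1) ⊆ cell (t.1 ∩ t'.1) := by
    have := M.complex.inter_subset_convexHull t.2.1 t'.2.1
    rw [← Finset.coe_inter] at this
    exact (Set.inter_subset_inter interior_subset interior_subset).trans this
  have hne : (t.1 ∩ t'.1).Nonempty := by
    rw [Finset.nonempty_iff_ne_empty]
    intro h
    simpa [h, cell] using hsub ⟨hx, hx'⟩
  have hface := M.complex.down_closed t.2.1 Finset.inter_subset_left hne
  have hcard := (interior_cell_nonempty_iff (M.complex.indep hface)).1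
    ⟨x, interior_maximal hsub (isOpen_interior.inter isOpen_interior) ⟨hx, hx'⟩⟩
  have h1 := Finset.eq_of_subset_of_card_le (Finset.inter_subset_left (s₁ := t.1) (s₂ := t'.1))
    (by rw [hcard, t.2.2])
  have h2 := Finset.eq_of_subset_of_card_le (Finset.inter_subset_right (s₁ := t.1) (s₂ := t'.1))
    (by rw [hcard, t'.2.2])
  exact Subtype.ext (h1.symm.trans h2)

theorem volume_domain_lt_top (M : Mesh) : volume M.domain < ⊤ := by
  have h : IsCompact M.complex.space :=
    M.finite.isCompact_biUnion fun s _ => isCompact_cell s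
  exact (measure_mono interior_subset).trans_lt h.measure_lt_top

theorem measurableSet_domain (M : Mesh) : MeasurableSet M.domain :=
  isOpen_interior.measurableSet

/-- The triangle lies in a Lipschitz image of the unit square, where two-dimensional Hausdorff
measure is Lebesgue measure. This makes the boundary integrands integrable. -/
theorem euclideanHausdorffMeasure_cell_lt_top {G : Finset E3} (hG : G.card = 3) :
    μHE[2] (cell G) < ⊤ := by
  classical
  obtain ⟨p, q, r, -, -, -, rfl⟩ := Finset.card_eq_three.1 hG
  let L : (Fin 2 → ℝ) →L[ℝ] E3 := (ContinuousLinearMap.proj 0).smulRight (q - p) +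
    (ContinuousLinearMap.proj 1).smulRight (r - p)
  let f : (Fin 2 → ℝ) →ᵃ[ℝ] E3 := L.toLinearMap.toAffineMap + AffineMap.const ℝ (Fin 2 → ℝ) p
  have hf (y : Fin 2 → ℝ) : f y = L y + p := rfl
  have hL (y : Fin 2 → ℝ) : L y = y 0 • (q - p) + y 1 • (r - p) := rfl
  have hlip : LipschitzWith (‖L‖₊ + 0) f :=
    L.lipschitz.add (LipschitzWith.const p)
  have hsub : cell {p, q, r} ⊆ f '' Set.Icc 0 1 := by
    refine convexHull_min ?_ ((convex_Icc 0 1).affine_image f)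
    intro y hy
    simp only [Finset.coe_insert, Finset.coe_singleton, Set.mem_insert_iff,
      Set.mem_singleton_iff] at hy
    rcases hy with rfl | rfl | rfl
    · exact ⟨0, by simp, by simp [hf, hL]⟩
    · refine ⟨![1, 0], ?_, by simp [hf, hL]⟩
      simp [Set.mem_Icc, Pi.le_def, Fin.forall_fin_two]
    · refine ⟨![0, 1], ?_, by simp [hf, hL]⟩
      simp [Set.mem_Icc, Pi.le_def, Fin.forall_fin_two]
  have h2 : (μH[2] : Measure (Fin 2 → ℝ)) = volume := by
    have := hausdorffMeasure_pi_real (ι := Fin 2)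
    simpa using this
  have hfin : μH[2] (cell {p, q, r}) < ⊤ := by
    refine (measure_mono hsub).trans_lt
      ((hlip.hausdorffMeasure_image_le zero_le_two _).trans_lt ?_)
    rw [h2]
    exact ENNReal.mul_lt_top (ENNReal.rpow_lt_top_of_nonneg zero_le_two ENNReal.coe_ne_top)
      isCompact_Icc.measure_lt_top
  rw [Measure.euclideanHausdorffMeasure_def, Measure.smul_apply]
  simpa [ENNReal.smul_def] using ENNReal.mul_lt_top ENNReal.coe_lt_top hfin

/-! ### Piecewise polynomials as functions -/

theorem glueS_of_mem (u : M.Tet → Poly) {t : M.Tet} {x : E3} (hx : x ∈ interior (cell t.1)) :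
    M.glueS u x = evalS (u t) x := by
  rw [glueS, Finset.sum_eq_single t, Set.indicator_of_mem hx]
  · intro t' _ hne
    exact Set.indicator_of_notMem (fun h => hne (eq_of_mem_interior_cell h hx)) _
  · simp

theorem glueV_of_mem (u : M.Tet → PolyVec) {t : M.Tet} {x : E3}
    (hx : x ∈ interior (cell t.1)) : M.glueV u x = evalV (u t) x := by
  rw [glueV, Finset.sum_eq_single t, Set.indicator_of_mem hx]
  · intro t' _ hne
    exact Set.indicator_of_notMem (fun h => hne (eq_of_mem_interior_cell h hx)) _
  · simp

theorem glueS_add (u v : M.Tet → Poly) (x : E3) :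
    M.glueS (u + v) x = M.glueS u x + M.glueS v x := by
  rw [glueS, glueS, glueS, ← Finset.sum_add_distrib]
  refine Finset.sum_congr rfl fun t _ => ?_
  by_cases hx : x ∈ interior (cell t.1) <;> simp [hx, evalS]

theorem glueS_smul (c : ℝ) (u : M.Tet → Poly) (x : E3) :
    M.glueS (c • u) x = c * M.glueS u x := by
  rw [glueS, glueS, Finset.mul_sum]
  refine Finset.sum_congr rfl fun t _ => ?_
  by_cases hx : x ∈ interior (cell t.1) <;> simp [hx, evalS]

theorem glueV_add (u v : M.Tet → PolyVec) (x : E3) :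
    M.glueV (u + v) x = M.glueV u x + M.glueV v x := by
  rw [glueV, glueV, glueV, ← Finset.sum_add_distrib]
  refine Finset.sum_congr rfl fun t _ => ?_
  by_cases hx : x ∈ interior (cell t.1) <;> simp [hx, evalV_add]

theorem glueV_smul (c : ℝ) (u : M.Tet → PolyVec) (x : E3) :
    M.glueV (c • u) x = c • M.glueV u x := by
  rw [glueV, glueV, Finset.smul_sum]
  refine Finset.sum_congr rfl fun t _ => ?_
  by_cases hx : x ∈ interior (cell t.1) <;> simp [hx, evalV_smul]

theorem measurable_glueS (u : M.Tet → Poly) : Measurable (M.glueS u) :=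
  Finset.measurable_fun_sum _ fun t _ =>
    (continuous_evalS (u t)).measurable.indicator isOpen_interior.measurableSet

theorem measurable_glueV (u : M.Tet → PolyVec) : Measurable (M.glueV u) :=
  Finset.measurable_fun_sum _ fun t _ =>
    (continuous_evalV (u t)).measurable.indicator isOpen_interior.measurableSet

theorem exists_norm_indicator_interior_cell_le {F : Type*} [NormedAddCommGroup F] {f : E3 → F}
    (hf : Continuous f) (s : Finset E3) :
    ∃ C, ∀ x, ‖(interior (cell s)).indicator f x‖ ≤ C := by
  obtain ⟨C, hC⟩ := (isCompact_cell s).exists_bound_of_continuousOn hf.continuousOn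
  refine ⟨max C 0, fun x => ?_⟩
  by_cases hx : x ∈ interior (cell s)
  · rw [Set.indicator_of_mem hx]
    exact (hC x (interior_subset hx)).trans (le_max_left _ _)
  · rw [Set.indicator_of_notMem hx, norm_zero]
    exact le_max_right _ _

theorem exists_norm_glueS_le (u : M.Tet → Poly) : ∃ C, ∀ x, ‖M.glueS u x‖ ≤ C := by
  choose C hC using fun t : M.Tet =>
    exists_norm_indicator_interior_cell_le (continuous_evalS (u t)) t.1
  exact ⟨∑ t, C t, fun x => norm_sum_le_of_le _ fun t _ => hC t x⟩

theorem exists_norm_glueV_le (u : M.Tet → PolyVec) : ∃ C, ∀ x, ‖M.glueV u x‖ ≤ C := by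
  choose C hC using fun t : M.Tet =>
    exists_norm_indicator_interior_cell_le (continuous_evalV (u t)) t.1
  exact ⟨∑ t, C t, fun x => norm_sum_le_of_le _ fun t _ => hC t x⟩

/-! ### The bilinear forms -/

theorem integrableOn_glueS_mul (u v : M.Tet → Poly) :
    IntegrableOn (fun x => M.glueS u x * M.glueS v x) M.domain := by
  obtain ⟨C, hC⟩ := exists_norm_glueS_le u
  obtain ⟨D, hD⟩ := exists_norm_glueS_le v
  refine Measure.integrableOn_of_bounded (M := C * D) (volume_domain_lt_top M).ne
    ((measurable_glueS u).mul (measurable_glueS v)).aestronglyMeasurable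
    (Filter.Eventually.of_forall fun x => ?_)
  rw [norm_mul]
  exact mul_le_mul (hC x) (hD x) (norm_nonneg _) ((norm_nonneg _).trans (hC x))

/-- Piecewise polynomials are bounded, so integrability of the weight suffices. -/
theorem integrableOn_inner_glueV {w : E3 → ℝ} (hw : IntegrableOn w M.domain)
    (u v : M.Tet → PolyVec) :
    IntegrableOn (fun x => w x * inner ℝ (M.glueV u x) (M.glueV v x)) M.domain := by
  obtain ⟨C, hC⟩ := exists_norm_glueV_le u
  obtain ⟨D, hD⟩ := exists_norm_glueV_le v
  refine Integrable.mul_bdd (c := C * D) hw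
    ((measurable_glueV u).inner (measurable_glueV v)).aestronglyMeasurable
    (Filter.Eventually.of_forall fun x => ?_)
  exact (norm_inner_le_norm _ _).trans
    (mul_le_mul (hC x) (hD x) (norm_nonneg _) ((norm_nonneg _).trans (hC x)))

theorem integrableOn_inner_tang {G : Finset E3} (hG : G.card = 3) (u v : PolyVec) :
    IntegrableOn (fun x => inner ℝ (tang G (evalV u x)) (tang G (evalV v x))) (cell G) μHE[2] := by
  refine ContinuousOn.integrableOn_of_subset_isCompact ?_ (isCompact_cell G)
    (isCompact_cell G).measurableSet subset_rfl (euclideanHausdorffMeasure_cell_lt_top hG).ne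
  fun_prop

theorem card_of_mem_impedance {G : Finset E3} (hG : G ∈ M.impedance) : G.card = 3 :=
  (M.impedance_subset hG).2.1

theorem ipS_comm (u v : M.Tet → Poly) : M.ipS u v = M.ipS v u := by
  simp only [ipS, mul_comm]

theorem ipV_comm (w : E3 → ℝ) (u v : M.Tet → PolyVec) : M.ipV w u v = M.ipV w v u := by
  simp only [ipV]
  simp_rw [real_inner_comm]

theorem ipBdry_comm (u v : M.Tet → PolyVec) : M.ipBdry u v = M.ipBdry v u := by
  simp only [ipBdry]
  simp_rw [real_inner_comm]

theorem ipS_add_left (u u' v : M.Tet → Poly) :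
    M.ipS (u + u') v = M.ipS u v + M.ipS u' v := by
  simp only [ipS, glueS_add, add_mul]
  exact integral_add (integrableOn_glueS_mul u v) (integrableOn_glueS_mul u' v)

theorem ipS_smul_left (c : ℝ) (u v : M.Tet → Poly) : M.ipS (c • u) v = c * M.ipS u v := by
  simp only [ipS, glueS_smul, mul_assoc]
  exact integral_const_mul _ _

theorem ipV_add_left {w : E3 → ℝ} (hw : IntegrableOn w M.domain) (u u' v : M.Tet → PolyVec) :
    M.ipV w (u + u') v = M.ipV w u v + M.ipV w u' v := by
  simp only [ipV, glueV_add, inner_add_left, mul_add]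
  exact integral_add (integrableOn_inner_glueV hw u v) (integrableOn_inner_glueV hw u' v)

theorem ipV_smul_left (w : E3 → ℝ) (c : ℝ) (u v : M.Tet → PolyVec) :
    M.ipV w (c • u) v = c * M.ipV w u v := by
  simp only [ipV, glueV_smul, real_inner_smul_left, mul_left_comm _ c]
  exact integral_const_mul _ _

theorem ipBdry_add_left (u u' v : M.Tet → PolyVec) :
    M.ipBdry (u + u') v = M.ipBdry u v + M.ipBdry u' v := by
  classical
  simp only [ipBdry, Pi.add_apply, evalV_add, map_add, inner_add_left, ← Finset.sum_add_distrib]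
  refine Finset.sum_congr rfl fun G hG => Finset.sum_congr rfl fun t _ => ?_
  have hc := card_of_mem_impedance hG
  exact integral_add (integrableOn_inner_tang hc _ _) (integrableOn_inner_tang hc _ _)

theorem ipBdry_smul_left (c : ℝ) (u v : M.Tet → PolyVec) :
    M.ipBdry (c • u) v = c * M.ipBdry u v := by
  classical
  simp only [ipBdry, Pi.smul_apply, evalV_smul, map_smul, real_inner_smul_left, Finset.mul_sum]
  exact Finset.sum_congr rfl fun G _ => Finset.sum_congr rfl fun t _ => integral_const_mul _ _

/-- `ipS` as a bilinear form. -/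
noncomputable def formS (M : Mesh) : LinearMap.BilinForm ℝ (M.Tet → Poly) :=
  LinearMap.mk₂ ℝ M.ipS ipS_add_left ipS_smul_left
    (fun u v v' => by rw [ipS_comm, ipS_add_left, ipS_comm v, ipS_comm v'])
    (fun c u v => by rw [ipS_comm, ipS_smul_left, ipS_comm v, smul_eq_mul])

/-- `ipV` as a bilinear form. -/
noncomputable def formV {w : E3 → ℝ} (hw : IntegrableOn w M.domain) :
    LinearMap.BilinForm ℝ (M.Tet → PolyVec) :=
  LinearMap.mk₂ ℝ (M.ipV w) (ipV_add_left hw) (ipV_smul_left w)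
    (fun u v v' => by rw [ipV_comm, ipV_add_left hw, ipV_comm w v, ipV_comm w v'])
    (fun c u v => by rw [ipV_comm, ipV_smul_left, ipV_comm w v, smul_eq_mul])

/-- `ipBdry` as a bilinear form. -/
noncomputable def formBdry (M : Mesh) : LinearMap.BilinForm ℝ (M.Tet → PolyVec) :=
  LinearMap.mk₂ ℝ M.ipBdry ipBdry_add_left ipBdry_smul_left
    (fun u v v' => by rw [ipBdry_comm, ipBdry_add_left, ipBdry_comm v, ipBdry_comm v'])
    (fun c u v => by rw [ipBdry_comm, ipBdry_smul_left, ipBdry_comm v, smul_eq_mul])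

theorem formS_isSymm (M : Mesh) : (formS M).IsSymm := ⟨ipS_comm⟩

theorem formV_isSymm {w : E3 → ℝ} (hw : IntegrableOn w M.domain) : (formV hw).IsSymm :=
  ⟨ipV_comm w⟩

theorem formBdry_isSymm (M : Mesh) : (formBdry M).IsSymm := ⟨ipBdry_comm⟩

theorem formS_self_nonneg (u : M.Tet → Poly) : 0 ≤ formS M u u :=
  integral_nonneg fun _ => mul_self_nonneg _

theorem formV_self_nonneg {w : E3 → ℝ} (hw : IntegrableOn w M.domain)
    (hpos : ∀ x ∈ M.domain, 0 < w x) (u : M.Tet → PolyVec) : 0 ≤ formV hw u u :=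
  setIntegral_nonneg (measurableSet_domain M) fun x hx =>
    mul_nonneg (hpos x hx).le real_inner_self_nonneg

theorem formBdry_self_nonneg (u : M.Tet → PolyVec) : 0 ≤ formBdry M u u :=
  Finset.sum_nonneg fun _ _ => Finset.sum_nonneg fun _ _ =>
    integral_nonneg fun _ => real_inner_self_nonneg

/-- Positivity of the weight forces the field to vanish almost everywhere, by continuity everywhere
inside each cell; a polynomial that vanishes on a nonempty open set is zero. -/
theorem eq_zero_of_formV_self_eq_zero {w : E3 → ℝ} (hw : IntegrableOn w M.domain)
    (hpos : ∀ x ∈ M.domain, 0 < w x) {u : M.Tet → PolyVec} (h : formV hw u u = 0) : u = 0 := by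
  have hae := (setIntegral_eq_zero_iff_of_nonneg_ae
    ((ae_restrict_iff' (measurableSet_domain M)).2 (Filter.Eventually.of_forall fun x hx =>
      mul_nonneg (hpos x hx).le real_inner_self_nonneg))
    (integrableOn_inner_glueV hw u u)).1 h
  funext t
  have hU : IsOpen (interior (cell t.1)) := isOpen_interior
  have h0 : evalV (u t) =ᵐ[volume.restrict (interior (cell t.1))] fun _ => 0 := by
    have h1 := ae_restrict_of_ae_restrict_of_subset (interior_cell_subset_domain t) hae
    filter_upwards [h1, ae_restrict_mem hU.measurableSet] with x hx hxt
    rw [glueV_of_mem u hxt] at hx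
    simpa [(hpos x (interior_cell_subset_domain t hxt)).ne'] using hx
  have h1 := Measure.eqOn_open_of_ae_eq h0 hU (continuous_evalV _).continuousOn
    continuousOn_const
  funext i
  refine eq_zero_of_evalS_eq_zero hU
    ((interior_cell_nonempty_iff (M.complex.indep t.2.1)).2 t.2.2) fun x hx => ?_
  exact congrArg (fun v : E3 => v i) (h1 hx)

theorem eq_zero_of_formS_self_eq_zero {u : M.Tet → Poly} (h : formS M u u = 0) : u = 0 := by
  have hae := (setIntegral_eq_zero_iff_of_nonneg_ae
    (Filter.Eventually.of_forall fun x => mul_self_nonneg _) (integrableOn_glueS_mul u u)).1 h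
  funext t
  have hU : IsOpen (interior (cell t.1)) := isOpen_interior
  have h0 : evalS (u t) =ᵐ[volume.restrict (interior (cell t.1))] fun _ => 0 := by
    have h1 := ae_restrict_of_ae_restrict_of_subset (interior_cell_subset_domain t) hae
    filter_upwards [h1, ae_restrict_mem hU.measurableSet] with x hx hxt
    rw [glueS_of_mem u hxt] at hx
    simpa using hx
  have h1 := Measure.eqOn_open_of_ae_eq h0 hU (continuous_evalS _).continuousOn
    continuousOn_const
  exact eq_zero_of_evalS_eq_zero hU
    ((interior_cell_nonempty_iff (M.complex.indep t.2.1)).2 t.2.2) fun x hx => h1 hx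

/-- Since `p` vanishes on all of ∂Ω, its gradient has no tangential trace on `Γ_i`: adding a
gradient to a test function costs nothing on the boundary. -/
theorem formBdry_grad (u : M.Tet → PolyVec) (p : M.hGrad k) :
    formBdry M u (fun t => grad (p.1 t)) = 0 := by
  classical
  refine Finset.sum_eq_zero fun G hG => Finset.sum_eq_zero fun t ht => ?_
  refine setIntegral_eq_zero_of_forall_eq_zero fun x hx => ?_
  have hGt : G ⊆ t.1 := (Finset.mem_filter.1 ht).2
  rw [tang_evalV_grad (fun y hy => p.2.2.2 t y
    ⟨convexHull_mono hGt hy, (M.impedance_subset hG).2.2 hy⟩) hx, inner_zero_right]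

end Mesh

end MaxwellFEM

namespace MaxwellFEM

/-- A scaled Cauchy--Schwarz inequality for positive semidefinite forms. -/
theorem abs_mul_form_le {V : Type*} [AddCommGroup V] [Module ℝ V] {b : LinearMap.BilinForm ℝ V}
    (hb : ∀ x, 0 ≤ b x x) (hs : b.IsSymm) {x y : V} {c α β m n : ℝ} (hα : 0 ≤ α) (hβ : 0 ≤ β)
    (hc : c ^ 2 = α * β) (hm : 0 ≤ m) (hn : 0 ≤ n) (hx : α * b x x ≤ m ^ 2)
    (hy : β * b y y ≤ n ^ 2) : |c * b x y| ≤ m * n := by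
  refine abs_le_of_sq_le_sq ?_ (mul_nonneg hm hn)
  calc (c * b x y) ^ 2 = α * β * (b x y) ^ 2 := by rw [mul_pow, hc]
    _ ≤ α * β * (b x x * b y y) :=
      mul_le_mul_of_nonneg_left (LinearMap.BilinForm.apply_sq_le_of_symm b hb ⟨hs.eq⟩ x y)
        (mul_nonneg hα hβ)
    _ = (α * b x x) * (β * b y y) := by ring
    _ ≤ m ^ 2 * n ^ 2 :=
      mul_le_mul hx hy (mul_nonneg hβ (hb y)) (sq_nonneg m)
    _ = (m * n) ^ 2 := by ring

namespace Mesh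

/-- The hypotheses on the data of the auxiliary problem. -/
structure Admissible (M : Mesh) (τ γ : ℝ) (ε μ : E3 → ℝ) : Prop where
  tau_pos : 0 < τ
  gamma_nonneg : 0 ≤ 1 + γ
  eps_pos : ∀ x ∈ M.domain, 0 < ε x
  inv_mu_pos : ∀ x ∈ M.domain, 0 < (μ x)⁻¹
  eps_int : IntegrableOn ε M.domain
  inv_mu_int : IntegrableOn (fun x => (μ x)⁻¹) M.domain

variable {M : Mesh} {k : ℕ} {τ γ : ℝ} {ε μ : E3 → ℝ}

/-- The elementwise gradient `H_{h,0}(grad) → H_{h,imp}(curl)`. -/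
noncomputable def gradL (M : Mesh) (k : ℕ) : M.hGrad k →ₗ[ℝ] M.hCurl k where
  toFun p := ⟨fun t => grad (p.1 t), grad_mem_hCurl p⟩
  map_add' p q := Subtype.ext (funext fun t => grad_add (p.1 t) (q.1 t))
  map_smul' c p := Subtype.ext (funext fun t => grad_smul c (p.1 t))

/-- The elementwise curl `H_{h,imp}(curl) → H_{h,imp}(div)`. -/
noncomputable def curlL (M : Mesh) (k : ℕ) : M.hCurl k →ₗ[ℝ] M.hDiv k where
  toFun E := ⟨fun t => curl (E.1 t), curl_mem_hDiv E⟩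
  map_add' E F := Subtype.ext (funext fun t => curl_add (E.1 t) (F.1 t))
  map_smul' c E := Subtype.ext (funext fun t => curl_smul c (E.1 t))

/-- The elementwise divergence on `H_{h,imp}(div)`. -/
noncomputable def divL (M : Mesh) (k : ℕ) : M.hDiv k →ₗ[ℝ] (M.Tet → Poly) where
  toFun B := fun t => div (B.1 t)
  map_add' B C := funext fun t => div_add (B.1 t) (C.1 t)
  map_smul' c B := funext fun t => div_smul c (B.1 t)

theorem curlL_gradL (p : M.hGrad k) : curlL M k (gradL M k p) = 0 :=
  Subtype.ext (funext fun t => curl_grad (p.1 t))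

theorem divL_curlL (E : M.hCurl k) : divL M k (curlL M k E) = 0 :=
  funext fun t => div_curl (E.1 t)

/-! ### The rows and the norm in terms of the bilinear forms -/

namespace Admissible

variable (h : Admissible M τ γ ε μ)
include h

/-- This and its companions hold by definition; in this form `map_add` and `map_smul` expand the
rows and norms. -/
theorem rowB_eq (U : M.Vh k) (C : M.hDiv k) :
    rowB τ μ U C = 2 / τ * formV h.inv_mu_int U.1 C
      + formV h.inv_mu_int (curlL M k U.2.1) C + formS M (divL M k U.1) (divL M k C) := rfl

theorem rowE_eq (U : M.Vh k) (F : M.hCurl k) :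
    rowE τ γ ε μ U F = 2 / τ * formV h.eps_int U.2.1 F
      + formV h.eps_int (gradL M k U.2.2) F - formV h.inv_mu_int U.1 (curlL M k F)
      + (1 + γ) * formBdry M U.2.1 F := rfl

theorem rowP_eq (U : M.Vh k) (q : M.hGrad k) :
    rowP τ ε U q = 2 / τ * formS M U.2.2 q - formV h.eps_int U.2.1 (gradL M k q) := rfl

theorem normSqDiv_eq (B : M.hDiv k) :
    normSqDiv τ μ B =
      2 / τ * formV h.inv_mu_int B B + formS M (divL M k B) (divL M k B) := rfl

theorem normSqCurl_eq (E : M.hCurl k) :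
    normSqCurl τ γ ε μ E = 2 / τ * formV h.eps_int E E
      + τ / 2 * formV h.inv_mu_int (curlL M k E) (curlL M k E)
      + (1 + γ) * formBdry M E E := rfl

theorem normSqGrad_eq (p : M.hGrad k) :
    normSqGrad τ ε p =
      2 / τ * formS M p p + τ / 2 * formV h.eps_int (gradL M k p) (gradL M k p) := rfl

theorem formMu_nonneg (u : M.Tet → PolyVec) : 0 ≤ formV h.inv_mu_int u u :=
  formV_self_nonneg _ h.inv_mu_pos u

theorem formEps_nonneg (u : M.Tet → PolyVec) : 0 ≤ formV h.eps_int u u :=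
  formV_self_nonneg _ h.eps_pos u

theorem two_div_tau_pos : 0 < 2 / τ := div_pos two_pos h.tau_pos

/-- The seven squares that make up the squared norm, and their sum. -/
theorem nrm_sq (U : M.Vh k) :
    nrm τ γ ε μ U ^ 2 =
      2 / τ * formV h.inv_mu_int U.1 U.1 + formS M (divL M k U.1) (divL M k U.1)
      + (2 / τ * formV h.eps_int U.2.1 U.2.1
      + τ / 2 * formV h.inv_mu_int (curlL M k U.2.1) (curlL M k U.2.1)
      + (1 + γ) * formBdry M U.2.1 U.2.1)
      + (2 / τ * formS M U.2.2 U.2.2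
      + τ / 2 * formV h.eps_int (gradL M k U.2.2) (gradL M k U.2.2)) := by
  have h1 := h.two_div_tau_pos.le
  have h2 := (half_pos h.tau_pos).le
  rw [nrm, h.normSqDiv_eq, h.normSqCurl_eq, h.normSqGrad_eq, Real.sq_sqrt]
  have a1 := mul_nonneg h1 (h.formMu_nonneg U.1)
  have a2 := formS_self_nonneg (divL M k U.1)
  have a3 := mul_nonneg h1 (h.formEps_nonneg U.2.1)
  have a4 := mul_nonneg h2 (h.formMu_nonneg (curlL M k U.2.1))
  have a5 := mul_nonneg h.gamma_nonneg (formBdry_self_nonneg (M := M) U.2.1)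
  have a6 := mul_nonneg h1 (formS_self_nonneg (M := M) U.2.2)
  have a7 := mul_nonneg h2 (h.formEps_nonneg (gradL M k U.2.2))
  positivity

theorem nrm_sq_bounds (U : M.Vh k) :
    2 / τ * formV h.inv_mu_int U.1 U.1 ≤ nrm τ γ ε μ U ^ 2 ∧
    formS M (divL M k U.1) (divL M k U.1) ≤ nrm τ γ ε μ U ^ 2 ∧
    2 / τ * formV h.eps_int U.2.1 U.2.1 ≤ nrm τ γ ε μ U ^ 2 ∧
    τ / 2 * formV h.inv_mu_int (curlL M k U.2.1) (curlL M k U.2.1) ≤ nrm τ γ ε μ U ^ 2 ∧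
    (1 + γ) * formBdry M U.2.1 U.2.1 ≤ nrm τ γ ε μ U ^ 2 ∧
    2 / τ * formS M U.2.2 U.2.2 ≤ nrm τ γ ε μ U ^ 2 ∧
    τ / 2 * formV h.eps_int (gradL M k U.2.2) (gradL M k U.2.2) ≤ nrm τ γ ε μ U ^ 2 := by
  have h1 := h.two_div_tau_pos.le
  have h2 := (half_pos h.tau_pos).le
  have a1 := mul_nonneg h1 (h.formMu_nonneg U.1)
  have a2 := formS_self_nonneg (divL M k U.1)
  have a3 := mul_nonneg h1 (h.formEps_nonneg U.2.1)
  have a4 := mul_nonneg h2 (h.formMu_nonneg (curlL M k U.2.1))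
  have a5 := mul_nonneg h.gamma_nonneg (formBdry_self_nonneg (M := M) U.2.1)
  have a6 := mul_nonneg h1 (formS_self_nonneg (M := M) U.2.2)
  have a7 := mul_nonneg h2 (h.formEps_nonneg (gradL M k U.2.2))
  rw [h.nrm_sq]
  refine ⟨?_, ?_, ?_, ?_, ?_, ?_, ?_⟩ <;> linarith

theorem eq_zero_of_nrm_eq_zero {U : M.Vh k} (hU : nrm τ γ ε μ U = 0) : U = 0 := by
  obtain ⟨hB, -, hE, -, -, hp, -⟩ := h.nrm_sq_bounds U
  rw [hU, zero_pow two_ne_zero] at hB hE hp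
  have key {a : ℝ} (ha : 0 ≤ a) (hle : 2 / τ * a ≤ 0) : a = 0 :=
    le_antisymm (nonpos_of_mul_nonpos_right hle h.two_div_tau_pos) ha
  refine Prod.ext (Subtype.ext ?_) (Prod.ext (Subtype.ext ?_) (Subtype.ext ?_))
  · exact eq_zero_of_formV_self_eq_zero _ h.inv_mu_pos (key (h.formMu_nonneg _) hB)
  · exact eq_zero_of_formV_self_eq_zero _ h.eps_pos (key (h.formEps_nonneg _) hE)
  · exact eq_zero_of_formS_self_eq_zero (key (formS_self_nonneg _) hp)

omit h in
theorem nrm_nonneg (U : M.Vh k) : 0 ≤ nrm τ γ ε μ U := Real.sqrt_nonneg _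

theorem nrm_pos {U : M.Vh k} (hU : U ≠ 0) : 0 < nrm τ γ ε μ U :=
  (nrm_nonneg U).lt_of_ne' fun h0 => hU (h.eq_zero_of_nrm_eq_zero h0)

/-! ### Boundedness -/

theorem abs_auxForm_le (U V : M.Vh k) :
    |auxForm τ γ ε μ U V| ≤ 9 * nrm τ γ ε μ U * nrm τ γ ε μ V := by
  have h1 := h.two_div_tau_pos.le
  have h2 := (half_pos h.tau_pos).le
  have hprod : 2 / τ * (τ / 2) = 1 := by
    have := h.tau_pos.ne'
    field_simp
  have hprod' : τ / 2 * (2 / τ) = 1 := by rw [mul_comm, hprod]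
  obtain ⟨u1, u2, u3, u4, u5, u6, u7⟩ := h.nrm_sq_bounds U
  obtain ⟨v1, v2, v3, v4, v5, v6, v7⟩ := h.nrm_sq_bounds V
  have hm := nrm_nonneg (τ := τ) (γ := γ) (ε := ε) (μ := μ) U
  have hn := nrm_nonneg (τ := τ) (γ := γ) (ε := ε) (μ := μ) V
  have sμ := formV_isSymm h.inv_mu_int
  have sε := formV_isSymm h.eps_int
  -- One estimate for each of the nine terms. In the coupling terms one factor carries `2 / τ` and
  -- the other `τ / 2`; their product is 1, hence the bound is free of `τ`.
  have t1 := abs_mul_form_le h.formMu_nonneg sμ h1 h1 (sq _) hm hn u1 v1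
  have t2 := abs_mul_form_le h.formMu_nonneg sμ (c := 1) h2 h1 (by rw [hprod', one_pow])
    hm hn u4 v1
  have t3 := abs_mul_form_le formS_self_nonneg (formS_isSymm M) (c := 1) zero_le_one zero_le_one
    (by norm_num) hm hn (by rwa [one_mul]) (by rwa [one_mul] : 1 * formS M (divL M k V.1) _ ≤ _)
  have t4 := abs_mul_form_le h.formEps_nonneg sε h1 h1 (sq _) hm hn u3 v3
  have t5 := abs_mul_form_le h.formEps_nonneg sε (c := 1) h2 h1 (by rw [hprod', one_pow])
    hm hn u7 v3
  have t6 := abs_mul_form_le h.formMu_nonneg sμ (c := 1) h1 h2 (by rw [hprod, one_pow])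
    hm hn u1 v4
  have t7 := abs_mul_form_le formBdry_self_nonneg (formBdry_isSymm M) h.gamma_nonneg
    h.gamma_nonneg (sq _) hm hn u5 v5
  have t8 := abs_mul_form_le formS_self_nonneg (formS_isSymm M) h1 h1 (sq _) hm hn u6 v6
  have t9 := abs_mul_form_le h.formEps_nonneg sε (c := 1) h1 h2 (by rw [hprod, one_pow])
    hm hn u3 v7
  rw [auxForm, h.rowB_eq, h.rowE_eq, h.rowP_eq]
  simp only [one_mul] at *
  rw [abs_le] at *
  constructor <;> linarith

/-! ### The inf-sup condition -/

omit h in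
/-- The test function `(B + (τ/2) curl E, E + (τ/2) grad p, p)`. -/
noncomputable def testFn (τ : ℝ) (U : M.Vh k) : M.Vh k :=
  (U.1 + (τ / 2) • curlL M k U.2.1, U.2.1 + (τ / 2) • gradL M k U.2.2, U.2.2)

omit h in
theorem form_add_smul_self {V : Type*} [AddCommGroup V] [Module ℝ V]
    {b : LinearMap.BilinForm ℝ V} (hs : b.IsSymm) (x y : V) (c : ℝ) :
    b (x + c • y) (x + c • y) = b x x + 2 * c * b x y + c ^ 2 * b y y := by
  have : b x y = b y x := hs.eq x y
  simp only [map_add, map_smul, LinearMap.add_apply, LinearMap.smul_apply, smul_eq_mul, ← this]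
  ring

omit h in
-- Young's inequality with the weights of the norm: expand `τ⁻¹ * b (x ± (τ / 2) • y) (x ± (τ / 2) •
-- y) ≥ 0`.
theorem abs_form_le_half_add {V : Type*} [AddCommGroup V] [Module ℝ V]
    {b : LinearMap.BilinForm ℝ V} (hb : ∀ x, 0 ≤ b x x) (hs : b.IsSymm) (hτ : 0 < τ) (x y : V) :
    |b x y| ≤ (2 / τ * b x x + τ / 2 * b y y) / 2 := by
  have h1 := mul_nonneg (inv_pos.2 hτ).le (hb (x + (τ / 2) • y))
  have h2 := mul_nonneg (inv_pos.2 hτ).le (hb (x + (-(τ / 2)) • y))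
  rw [form_add_smul_self hs] at h1 h2
  have e1 : τ⁻¹ * (b x x + 2 * (τ / 2) * b x y + (τ / 2) ^ 2 * b y y) =
      (2 / τ * b x x + τ / 2 * b y y) / 2 + b x y := by
    field_simp
    ring
  have e2 : τ⁻¹ * (b x x + 2 * (-(τ / 2)) * b x y + (-(τ / 2)) ^ 2 * b y y) =
      (2 / τ * b x x + τ / 2 * b y y) / 2 - b x y := by
    field_simp
    ring
  rw [e1] at h1
  rw [e2] at h2
  rw [abs_le]
  constructor <;> linarith

/-- Each coupling appears three times, twice with a plus and once with a minus sign, so one copy of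
$(\mu^{-1}B,{\rm curl}\,E)$ and one of $(\varepsilon E,{\rm grad}\,p)$ survive. They involve
disjoint parts of the squared norm, and Young's inequality takes half of each. -/
theorem nrm_sq_le_auxForm_testFn (U : M.Vh k) :
    1 / 2 * nrm τ γ ε μ U ^ 2 ≤ auxForm τ γ ε μ U (testFn τ U) := by
  have hτ := h.tau_pos.ne'
  have bμ := abs_le.1 (abs_form_le_half_add h.formMu_nonneg (formV_isSymm h.inv_mu_int) h.tau_pos
    (U.1 : M.Tet → PolyVec) (curlL M k U.2.1))
  have bε := abs_le.1 (abs_form_le_half_add h.formEps_nonneg (formV_isSymm h.eps_int) h.tau_pos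
    (U.2.1 : M.Tet → PolyVec) (gradL M k U.2.2))
  have sμ := (formV_isSymm h.inv_mu_int).eq U.1 (curlL M k U.2.1)
  have sε := (formV_isSymm h.eps_int).eq U.2.1 (gradL M k U.2.2)
  have hΓ : formBdry M U.2.1 (gradL M k U.2.2) = 0 := formBdry_grad _ _
  have a2 := formS_self_nonneg (divL M k U.1)
  have a5 := mul_nonneg h.gamma_nonneg (formBdry_self_nonneg (M := M) U.2.1)
  have a6 := mul_nonneg h.two_div_tau_pos.le (formS_self_nonneg (M := M) U.2.2)
  rw [h.nrm_sq, auxForm, h.rowB_eq, h.rowE_eq, h.rowP_eq]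
  simp only [testFn, Submodule.coe_add, Submodule.coe_smul, map_add, map_smul, smul_eq_mul,
    curlL_gradL, divL_curlL, smul_zero, add_zero, hΓ, mul_zero] at sμ sε ⊢
  rw [← sμ, ← sε]
  have e (a : ℝ) : 2 / τ * (τ / 2 * a) = a := by field_simp
  simp only [mul_add, e] at *
  linarith

/-- Young's inequality at most doubles the squares it touches. Those of curl E and grad p also occur
once unchanged, which gives a factor 3 on the squared norm, rounded up to 4. -/
theorem nrm_testFn_le (U : M.Vh k) : nrm τ γ ε μ (testFn τ U) ≤ 2 * nrm τ γ ε μ U := by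
  refine abs_le_of_sq_le_sq' ?_ (mul_nonneg zero_le_two (nrm_nonneg U)) |>.2
  have hτ := h.tau_pos.ne'
  have bμ := abs_le.1 (abs_form_le_half_add h.formMu_nonneg (formV_isSymm h.inv_mu_int) h.tau_pos
    (U.1 : M.Tet → PolyVec) (curlL M k U.2.1))
  have bε := abs_le.1 (abs_form_le_half_add h.formEps_nonneg (formV_isSymm h.eps_int) h.tau_pos
    (U.2.1 : M.Tet → PolyVec) (gradL M k U.2.2))
  have hΓ (u : M.Tet → PolyVec) : formBdry M u (gradL M k U.2.2) = 0 := formBdry_grad _ _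
  have h1 := h.two_div_tau_pos.le
  have h2 := (half_pos h.tau_pos).le
  have a1 := mul_nonneg h1 (h.formMu_nonneg U.1)
  have a2 := formS_self_nonneg (divL M k U.1)
  have a3 := mul_nonneg h1 (h.formEps_nonneg U.2.1)
  have a4 := mul_nonneg h2 (h.formMu_nonneg (curlL M k U.2.1))
  have a5 := mul_nonneg h.gamma_nonneg (formBdry_self_nonneg (M := M) U.2.1)
  have a6 := mul_nonneg h1 (formS_self_nonneg (M := M) U.2.2)
  have a7 := mul_nonneg h2 (h.formEps_nonneg (gradL M k U.2.2))
  rw [mul_pow, h.nrm_sq, h.nrm_sq]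
  simp only [testFn, Submodule.coe_add, Submodule.coe_smul, map_add (curlL M k),
    map_smul (curlL M k), map_add (divL M k), map_smul (divL M k),
    curlL_gradL, divL_curlL, smul_zero, add_zero, form_add_smul_self (formV_isSymm _),
    form_add_smul_self (formBdry_isSymm M), hΓ, mul_zero]
  have e (a b c : ℝ) : 2 / τ * (a + 2 * (τ / 2) * b + (τ / 2) ^ 2 * c) =
      2 / τ * a + 2 * b + τ / 2 * c := by field_simp
  rw [e, e]
  linarith

theorem bddAbove_quotient (U : M.Vh k) :
    BddAbove (Set.range fun V : {V : M.Vh k // V ≠ 0} =>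
      auxForm τ γ ε μ U V.1 / nrm τ γ ε μ V.1) := by
  refine ⟨9 * nrm τ γ ε μ U, ?_⟩
  rintro _ ⟨V, rfl⟩
  exact (div_le_iff₀ (h.nrm_pos V.2)).2 ((le_abs_self _).trans (h.abs_auxForm_le U V.1))

theorem nrm_le_iSup (U : M.Vh k) :
    1 / 4 * nrm τ γ ε μ U ≤
      ⨆ V : {V : M.Vh k // V ≠ 0}, auxForm τ γ ε μ U V.1 / nrm τ γ ε μ V.1 := by
  have hlow := h.nrm_sq_le_auxForm_testFn U
  by_cases hU : nrm τ γ ε μ U = 0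
  -- Here `U = 0` and its test function is 0, which is no competitor. The supremum is still
  -- nonnegative; over an empty index type it is 0 by convention.
  · rw [hU, mul_zero]
    have hU0 := h.eq_zero_of_nrm_eq_zero hU
    refine Real.iSup_nonneg fun V => div_nonneg ?_ (nrm_nonneg _)
    have := h.abs_auxForm_le U V.1
    rw [hU, mul_zero, zero_mul] at this
    exact (abs_nonpos_iff.1 this).ge
  have hpos : 0 < nrm τ γ ε μ U := (nrm_nonneg U).lt_of_ne' hU
  have ha : 0 < auxForm τ γ ε μ U (testFn τ U) := lt_of_lt_of_le (by positivity) hlow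
  -- Otherwise boundedness would force `auxForm` to vanish at this pair, against `ha`.
  have hn : nrm τ γ ε μ (testFn τ U) ≠ 0 := by
    intro h0
    have := h.abs_auxForm_le U (testFn τ U)
    rw [h0, mul_zero, abs_nonpos_iff] at this
    exact ha.ne' this
  have hn' : 0 < nrm τ γ ε μ (testFn τ U) := (nrm_nonneg _).lt_of_ne' hn
  have hV : testFn τ U ≠ 0 := by
    intro h0
    have := h.nrm_sq (testFn τ U)
    rw [h0] at this hn
    simp at this
    exact hn this
  refine le_trans ?_ (le_ciSup (h.bddAbove_quotient U) ⟨testFn τ U, hV⟩)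
  rw [le_div_iff₀ hn']
  -- With N the norm of `U`: (1/4) N · |||V||| ≤ (1/4) N · 2N = (1/2) N² ≤ a(U; V).
  have := mul_le_mul_of_nonneg_left (h.nrm_testFn_le U) (nrm_nonneg (τ := τ) (γ := γ) (ε := ε)
    (μ := μ) U)
  linarith

/-! ### Well-posedness -/

theorem nrm_le_of_forall_auxForm_le {U : M.Vh k} {K : ℝ} (hK : 0 ≤ K)
    (hU : ∀ V : M.Vh k, auxForm τ γ ε μ U V ≤ K * nrm τ γ ε μ V) : nrm τ γ ε μ U ≤ 4 * K := by
  -- `hK` covers the case of an empty index type, where the supremum is 0.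
  have hsup := (h.nrm_le_iSup U).trans
    (Real.iSup_le (fun V => (div_le_iff₀ (h.nrm_pos V.2)).2 (hU V.1)) hK)
  linarith

/-- The bilinear form `a` on `V_h`. -/
noncomputable def auxBilin (k : ℕ) : LinearMap.BilinForm ℝ (M.Vh k) :=
  LinearMap.mk₂ ℝ (auxForm τ γ ε μ)
    (fun U U' V => by
      simp only [auxForm, h.rowB_eq, h.rowE_eq, h.rowP_eq, Prod.fst_add, Prod.snd_add,
        Submodule.coe_add, map_add, LinearMap.add_apply]
      ring)
    (fun c U V => by
      simp only [auxForm, h.rowB_eq, h.rowE_eq, h.rowP_eq, Prod.smul_fst, Prod.smul_snd,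
        Submodule.coe_smul, map_smul, LinearMap.smul_apply, smul_eq_mul]
      ring)
    (fun U V V' => by
      simp only [auxForm, h.rowB_eq, h.rowE_eq, h.rowP_eq, Prod.fst_add, Prod.snd_add,
        Submodule.coe_add, map_add]
      ring)
    (fun c U V => by
      simp only [auxForm, h.rowB_eq, h.rowE_eq, h.rowP_eq, Prod.smul_fst, Prod.smul_snd,
        Submodule.coe_smul, map_smul, smul_eq_mul]
      ring)

theorem auxBilin_apply (U V : M.Vh k) : h.auxBilin k U V = auxForm τ γ ε μ U V := rfl

theorem auxBilin_injective (k : ℕ) : Function.Injective (h.auxBilin k) := by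
  refine (injective_iff_map_eq_zero _).2 fun U hU => ?_
  have := h.nrm_le_of_forall_auxForm_le (U := U) le_rfl fun V => by
    rw [← h.auxBilin_apply, hU, LinearMap.zero_apply, zero_mul]
  rw [mul_zero] at this
  exact h.eq_zero_of_nrm_eq_zero (this.antisymm (nrm_nonneg U))

/-- A finite-dimensional space and its dual have equal dimension, so injectivity suffices. -/
theorem auxBilin_surjective (k : ℕ) : Function.Surjective (h.auxBilin k) :=
  (LinearMap.injective_iff_surjective_of_finrank_eq_finrank
    (Subspace.dual_finrank_eq (K := ℝ) (V := M.Vh k)).symm).1 (h.auxBilin_injective k)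

/-- Summing the rows gives the single equation; testing with triples that have two zero entries
recovers each row. -/
theorem isAuxSolution_iff {gB : M.hDiv k →ₗ[ℝ] ℝ} {gE : M.hCurl k →ₗ[ℝ] ℝ}
    {gp : M.hGrad k →ₗ[ℝ] ℝ} {U : M.Vh k} :
    IsAuxSolution τ γ ε μ gB gE gp U ↔ h.auxBilin k U = gB.coprod (gE.coprod gp) := by
  constructor
  · rintro ⟨hB, hE, hp⟩
    ext V <;>
      simp [auxBilin_apply, auxForm, hB, hE, hp]
  · intro hU
    have key (V : M.Vh k) : rowB τ μ U V.1 + rowE τ γ ε μ U V.2.1 + rowP τ ε U V.2.2 =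
        gB V.1 + (gE V.2.1 + gp V.2.2) := LinearMap.congr_fun hU V
    refine ⟨fun C => ?_, fun F => ?_, fun q => ?_⟩
    · simpa [h.rowE_eq, h.rowP_eq] using key (C, 0, 0)
    · simpa [h.rowB_eq, h.rowP_eq] using key (0, F, 0)
    · simpa [h.rowB_eq, h.rowE_eq] using key (0, 0, q)

end Admissible

end Mesh

end MaxwellFEM

/-! ### The theorem -/

open MaxwellFEM MaxwellFEM.Mesh in
theorem theorem3p1 :
    ∃ Cb : ℝ, 0 < Cb ∧
      ∀ (M : MaxwellFEM.Mesh) (k : ℕ) (τ γ : ℝ) (ε μ : MaxwellFEM.E3 → ℝ),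
        0 < τ → 0 ≤ 1 + γ →
        ContinuousOn ε M.domain → ContinuousOn μ M.domain →
        (∀ x ∈ M.domain, 0 < ε x) → (∀ x ∈ M.domain, 0 < μ x) →
        MeasureTheory.IntegrableOn ε M.domain →
        MeasureTheory.IntegrableOn (fun x => (μ x)⁻¹) M.domain →
        -- inf-sup condition
        (∀ U : M.Vh k,
          BddAbove (Set.range fun V : {V : M.Vh k // V ≠ 0} =>
            auxForm τ γ ε μ U V.1 / nrm τ γ ε μ V.1) ∧
          1 / 4 * nrm τ γ ε μ U ≤
            ⨆ V : {V : M.Vh k // V ≠ 0}, auxForm τ γ ε μ U V.1 / nrm τ γ ε μ V.1) ∧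
        -- boundedness
        (∀ U V : M.Vh k, |auxForm τ γ ε μ U V| ≤ Cb * nrm τ γ ε μ U * nrm τ γ ε μ V) ∧
        -- well-posedness, with a stability estimate that is uniform in all data
        (∀ (gB : M.hDiv k →ₗ[ℝ] ℝ) (gE : M.hCurl k →ₗ[ℝ] ℝ) (gp : M.hGrad k →ₗ[ℝ] ℝ),
          ∃ U : M.Vh k, IsAuxSolution τ γ ε μ gB gE gp U ∧
            (∀ U' : M.Vh k, IsAuxSolution τ γ ε μ gB gE gp U' → U' = U) ∧
            ∀ K : ℝ, 0 ≤ K →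
              (∀ V : M.Vh k, |gB V.1 + gE V.2.1 + gp V.2.2| ≤ K * nrm τ γ ε μ V) →
              nrm τ γ ε μ U ≤ 4 * K) := by
  refine ⟨9, by norm_num, fun M k τ γ ε μ hτ hγ _ _ hε hμ hεi hμi => ?_⟩
  have h : Admissible M τ γ ε μ := ⟨hτ, hγ, hε, fun x hx => inv_pos.2 (hμ x hx), hεi, hμi⟩
  refine ⟨fun U => ⟨h.bddAbove_quotient U, h.nrm_le_iSup U⟩, h.abs_auxForm_le,
    fun gB gE gp => ?_⟩
  obtain ⟨U, hU⟩ := h.auxBilin_surjective k (gB.coprod (gE.coprod gp))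
  refine ⟨U, h.isAuxSolution_iff.2 hU, fun U' hU' =>
    h.auxBilin_injective k ((h.isAuxSolution_iff.1 hU').trans hU.symm), fun K hK hg => ?_⟩
  refine h.nrm_le_of_forall_auxForm_le hK fun V => ?_
  refine (le_of_eq ?_).trans ((le_abs_self _).trans (hg V))
  rw [← h.auxBilin_apply, hU]
  simp [add_assoc]
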